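/- Fix $\lambda\in(0,1)$, $\mu>0$, $\nu>0$. For $N\ge 0$ and a set $\mathcal K\subseteq\{1,\dots,N\}$ of $k$ servers, consider the following system (the TABS scheme with $k$ infinite queues). There are $N$ parallel servers. Tasks arrive as a Poisson process of rate $\lambda N$ and have independent unit-mean exponential service requirements. The servers in $\mathcal K$ have infinite queues at all times (hence are always busy); each other server is busy (with a finite number $\ge 1$ of tasks), idle-on, idle-off, or in setup mode. A server whose queue empties becomes idle-on; an idle-on server turns idle-off after an $\mathrm{Exp}(\mu)$ time unless it gets a task before; a server in setup mode becomes idle-on after an $\mathrm{Exp}(\nu)$ time. An arriving task is assigned to an idle-on server chosen uniformly at random, if there is one. Otherwise it is assigned to a busy server chosen uniformly at random (and is lost if there is none), and if moreover there is an idle-off server, then one of these, chosen uniformly at random, enters setup mode. All choices and times are independent. This is a continuous-time Markov chain for the states of the $N-k$ servers with finite queues, and the system is called stable if this chain is positive recurrent. Let $Q_1^N$ be the number of busy servers (those in $\mathcal K$ included), $q_1^N=Q_1^N/N$, and let $q_1^N(\infty)$ denote $q_1^N$ under the stationary distribution. There exist $\varepsilon_1>0$ and $C_q>0$ (depending only on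 $\lambda,\mu,\nu$) such that the following holds. Consider any sequence of such systems with $N\to\infty$ and with $k=k(N)$ infinite queues such that $k(N)/N\to\kappa$ for some $\kappa\in[0,1]$, and assume that each of these systems is stable. Then for all sufficiently large $N$ along the sequence, $$\mathbb P\big(q_1^N(\infty)<\varepsilon_1\big)\le \mathrm e^{-C_qN}.$$ -/

import Mathlib

open scoped NNReal ENNReal Topology

noncomputable section

/-! ### Continuous-time Markov chains with finitely many transition types -/

/-- A continuous-time Markov chain on `S` described by finitely many types `e : E` of transitions:
in state `x` a transition of type `e` occurs at exponential rate `rate x e`, and it moves the chain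
to `jump x e`. -/
structure JumpChain (S E : Type) where
  rate : S → E → ℝ≥0
  jump : S → E → S

namespace JumpChain

variable {S E : Type} [Fintype E]

/-- The generator `(L f)(x) = ∑ e, rate x e * (f (jump x e) - f x)`. -/
def generator (M : JumpChain S E) (f : S → ℝ) (x : S) : ℝ :=
  ∑ e, (M.rate x e : ℝ) * (f (M.jump x e) - f x)

/-- The transition function `P_t(x, y) = (exp (t L) 1_{y}) (x)`, given by the exponential series
of the generator. The series converges absolutely when the rates are bounded, and it is then the
transition function of the unique Markov process with generator `L`. -/
def transitionProb (M : JumpChain S E) (t : ℝ) (x y : S) : ℝ :=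
  ∑' n : ℕ, t ^ n / (n.factorial : ℝ) * (M.generator^[n] (Set.indicator {y} 1)) x

/-- `π` is a stationary distribution: `π P_t = π` for every `t ≥ 0`. -/
def IsStationary (M : JumpChain S E) (π : PMF S) : Prop :=
  ∀ t : ℝ, 0 ≤ t → ∀ y : S, ∑' x, (π x).toReal * M.transitionProb t x y = (π y).toReal

open Classical in
/-- The total rate at which the chain leaves the state `x` (transitions that do not change the
state are not counted). -/
def exitRate (M : JumpChain S E) (x : S) : ℝ≥0 :=
  ∑ e with M.jump x e ≠ x, M.rate x e

open Classical in
/-- `E_x[min (T_z, J_n)]`, where `J_n` is the time of the `n`-th change of state and `T_z > 0` is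
the first time at which the chain jumps into the state `z`. The recursion is the first-step
decomposition: the chain stays in `x` for a mean time `1 / exitRate x`, then it jumps to
`jump x e` with probability `rate x e / exitRate x`. -/
def truncatedReturnTime (M : JumpChain S E) (z : S) : ℕ → S → ℝ≥0∞
  | 0, _ => 0
  | n + 1, x =>
    (1 + ∑ e with M.jump x e ≠ x,
      (M.rate x e : ℝ≥0∞) *
        (if M.jump x e = z then 0 else truncatedReturnTime M z n (M.jump x e)))
      / (M.exitRate x : ℝ≥0∞)

/-- The mean return time `E_z[T_z]` (for bounded rates `J_n → ∞`, so it is the monotone limit of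
the truncated means). -/
def meanReturnTime (M : JumpChain S E) (z : S) : ℝ≥0∞ :=
  ⨆ n, M.truncatedReturnTime z n z

/-- Positive recurrence: each state is absorbing or has a finite mean return time. -/
def PositiveRecurrent (M : JumpChain S E) : Prop :=
  ∀ z, M.exitRate z = 0 ∨ M.meanReturnTime z < ∞

end JumpChain

/-! ### The TABS scheme -/

namespace TABS

/-- State of a server with a finite queue: idle-off, in setup mode, or turned on with `n` tasks
(in queue or in service). An idle-on server is `on 0`, and `on n` with `1 ≤ n` is busy. -/
inductive Server : Type
  | off : Server
  | setup : Server
  | on (n : ℕ) : Server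

namespace Server

/-- The number of tasks at the server. -/
def tasks : Server → ℕ
  | on n => n
  | _ => 0

/-- The server after one more task is assigned to it (only servers that are on get tasks). -/
def addTask : Server → Server
  | on n => on (n + 1)
  | s => s

/-- The rate of the transition that the server makes of its own accord: a service completion at
rate `1` if it is busy, the end of the standby period at rate `μ` if it is idle-on, the end of the
setup period at rate `ν` if it is in setup mode. -/
def ownRate (μ ν : ℝ≥0) : Server → ℝ≥0
  | off => 0
  | setup => ν
  | on 0 => μ
  | on (_ + 1) => 1

/-- The state of the server after that transition. -/
def next : Server → Server
  | off => off
  | setup => on 0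
  | on 0 => off
  | on (n + 1) => on n

end Server

variable {N : ℕ} {K : Finset (Fin N)}

/-- State of a system of `N` servers in which the servers with index in `K` have infinite queues:
the states of the remaining servers. -/
abbrev State (K : Finset (Fin N)) : Type := {i : Fin N // i ∉ K} → Server

/-- The queue length of server `i`, including the task in service. -/
def queueLength (x : State K) (i : Fin N) : ℕ∞ :=
  if h : i ∈ K then ⊤ else ((x ⟨i, h⟩).tasks : ℕ∞)

open Classical in
/-- `Q_i`, the number of servers with queue length at least `i`. -/
def Q (x : State K) (i : ℕ) : ℕ :=
  (Finset.univ.filter fun j : Fin N => (i : ℕ∞) ≤ queueLength x j).card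

/-- `q_i = Q_i / N`. -/
def q (x : State K) (i : ℕ) : ℝ := (Q x i : ℝ) / (N : ℝ)

open Classical in
/-- The busy servers (those with an infinite queue are among them). -/
def busy (x : State K) : Finset (Fin N) :=
  Finset.univ.filter fun j => 1 ≤ queueLength x j

open Classical in
/-- The idle-on servers (green messages at the dispatcher). -/
def idleOn (x : State K) : Finset (Fin N) :=
  Finset.univ.filter fun j => ∃ h : j ∉ K, x ⟨j, h⟩ = Server.on 0

open Classical in
/-- The idle-off servers (red messages at the dispatcher). -/
def idleOff (x : State K) : Finset (Fin N) :=
  Finset.univ.filter fun j => ∃ h : j ∉ K, x ⟨j, h⟩ = Server.off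

/-- The probability that a uniform choice from `A` gives `o`; when `A` is empty, no element is
chosen, which is the outcome `none`. -/
def uniformPick (A : Finset (Fin N)) : Option (Fin N) → ℝ≥0
  | none => if A = ∅ then 1 else 0
  | some i => if i ∈ A then (A.card : ℝ≥0)⁻¹ else 0

/-- The servers among which the dispatcher chooses for an arriving task: the idle-on ones if there
are any, otherwise the busy ones (if there are none of those either, the task is lost). -/
def receivers (x : State K) : Finset (Fin N) :=
  if idleOn x = ∅ then busy x else idleOn x

/-- The servers among which one is chosen to start its setup procedure at an arrival epoch: the
idle-off ones if the arriving task finds no idle-on server, otherwise none. -/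
def setupCandidates (x : State K) : Finset (Fin N) :=
  if idleOn x = ∅ then idleOff x else ∅

/-- Types of transitions: `Sum.inl (b, c)` is an arrival of a task that is assigned to the server
`b` (`none`: the task is lost) and that makes the server `c` start its setup procedure (`none`: no
server does); `Sum.inr i` is the transition that the server `i` makes of its own accord. Service
completions at infinite queues do not change the state. -/
abbrev Event (K : Finset (Fin N)) : Type :=
  (Option (Fin N) × Option (Fin N)) ⊕ {i : Fin N // i ∉ K}

/-- The state after an arrival of type `(b, c)`. -/
def arrive (x : State K) (b c : Option (Fin N)) : State K := fun i =>
  if c = some i.1 then Server.setup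
  else if b = some i.1 then (x i).addTask
  else x i

/-- The Markov chain of the TABS scheme with `N` servers, arrival rate `lam * N`, unit service
rate, standby rate `μ` and setup rate `ν`, in which the servers in `K` have infinite queues. -/
def chain (lam μ ν : ℝ≥0) (K : Finset (Fin N)) : JumpChain (State K) (Event K) where
  rate x
    | Sum.inl (b, c) =>
      lam * (N : ℝ≥0) * (uniformPick (receivers x) b * uniformPick (setupCandidates x) c)
    | Sum.inr i => (x i).ownRate μ ν
  jump x
    | Sum.inl (b, c) => arrive x b c
    | Sum.inr i => Function.update x i (x i).next

/-- Stability of the system: positive recurrence of its Markov chain. -/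
def Stable (lam μ ν : ℝ≥0) (K : Finset (Fin N)) : Prop :=
  (chain lam μ ν K).PositiveRecurrent

end TABS

end

/-! A Lyapunov argument with an exponential test function. Take `V = Q₁ + a * min I m + d * U`,
where `I` counts idle-on servers, `U` counts servers in setup, `a` is slightly below `1`, and `m`,
`d * N` are small multiples of `N`. While `Q₁ < β * N`, the drift of `V` is at least `c * N`
(`generator_potential_ge_of_few_busy`). If some server is idle-on, each arrival turns such a server
busy and gains at least `1 - a`, at rate `lam * N`. If none is idle-on but some are off, each
arrival starts a setup and gains `d`. If there are neither, nearly all servers are in setup and each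
gains `a - d` at rate `ν`. In every case the losses are of smaller order in `β` or a fixed fraction
of the gain.

All jumps of `V` are bounded by `1` and the total rate is at most `R * N`. Hence for small `θ` the
function `f = exp (-θ V)` has generator at most `-(θ * c / 2) * N * f` where few servers are busy,
and at most `2 * R * N * exp (-θ β N)` elsewhere, because `V ≥ Q₁`. Under a stationary law the
generator of a bounded function has mean zero (`IsStationary.tsum_generator_eq_zero`). Balancing the
two regions bounds the mass of `{q₁ < β / 3}`, where `f` is at least `exp (-(2 / 3) θ β N)`, by a
constant times `exp (-θ β N / 3)` (`toOuterMeasure_q_lt_le`). -/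

namespace PMF

/-! ### Expectations of bounded functions under a `PMF`. -/

variable {S : Type}

theorem summable_toReal (π : PMF S) : Summable fun x => (π x).toReal :=
  ENNReal.summable_toReal (by rw [π.tsum_coe]; exact ENNReal.one_ne_top)

theorem tsum_toReal (π : PMF S) : ∑' x, (π x).toReal = 1 := by
  rw [← ENNReal.tsum_toReal_eq (fun x => π.apply_ne_top x), π.tsum_coe, ENNReal.toReal_one]

theorem summable_toReal_mul (π : PMF S) {f : S → ℝ} {C : ℝ} (hf : ∀ x, |f x| ≤ C) :
    Summable fun x => (π x).toReal * f x := by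
  refine Summable.of_norm_bounded (π.summable_toReal.mul_right C) fun x => ?_
  rw [Real.norm_eq_abs, abs_mul, abs_of_nonneg ENNReal.toReal_nonneg]
  exact mul_le_mul_of_nonneg_left (hf x) ENNReal.toReal_nonneg

theorem abs_tsum_toReal_mul_le (π : PMF S) {f : S → ℝ} {C : ℝ} (hf : ∀ x, |f x| ≤ C) :
    |∑' x, (π x).toReal * f x| ≤ C := by
  have h := tsum_of_norm_bounded (f := fun x => (π x).toReal * f x)
    ((π.summable_toReal.mul_right C).hasSum) fun x => by
      rw [Real.norm_eq_abs, abs_mul, abs_of_nonneg ENNReal.toReal_nonneg]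
      exact mul_le_mul_of_nonneg_left (hf x) ENNReal.toReal_nonneg
  rwa [tsum_mul_right, π.tsum_toReal, one_mul] at h

end PMF

/-! ### Stationarity in terms of the generator, for bounded rates. -/

namespace JumpChain

variable {S E : Type} [Fintype E]

theorem abs_generator_le (M : JumpChain S E) {R C : ℝ}
    (hR : ∀ x, ∑ e, (M.rate x e : ℝ) ≤ R) (hC : 0 ≤ C) {f : S → ℝ} (hf : ∀ x, |f x| ≤ C) (x : S) :
    |M.generator f x| ≤ 2 * R * C := by
  calc |M.generator f x| ≤ ∑ e, |(M.rate x e : ℝ) * (f (M.jump x e) - f x)| :=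
        Finset.abs_sum_le_sum_abs _ _
    _ ≤ ∑ e, (M.rate x e : ℝ) * (2 * C) := by
        refine Finset.sum_le_sum fun e _ => ?_
        rw [abs_mul, abs_of_nonneg (M.rate x e).coe_nonneg]
        refine mul_le_mul_of_nonneg_left ?_ (M.rate x e).coe_nonneg
        have h₁ := abs_le.1 (hf (M.jump x e))
        have h₂ := abs_le.1 (hf x)
        exact abs_le.2 ⟨by linarith, by linarith⟩
    _ = (∑ e, (M.rate x e : ℝ)) * (2 * C) := by rw [Finset.sum_mul]
    _ ≤ R * (2 * C) := mul_le_mul_of_nonneg_right (hR x) (by linarith)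
    _ = 2 * R * C := by ring

theorem abs_generator_iterate_le (M : JumpChain S E) {R : ℝ} (hR0 : 0 ≤ R)
    (hR : ∀ x, ∑ e, (M.rate x e : ℝ) ≤ R) {f : S → ℝ} (hf : ∀ x, |f x| ≤ 1) (n : ℕ) (x : S) :
    |(M.generator^[n] f) x| ≤ (2 * R) ^ n := by
  induction n generalizing x with
  | zero => simpa using hf x
  | succ n ih =>
    rw [Function.iterate_succ_apply', pow_succ']
    exact M.abs_generator_le hR (by positivity) ih x

theorem abs_indicator_singleton_le (y x : S) : |Set.indicator {y} (1 : S → ℝ) x| ≤ 1 := by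
  by_cases h : x = y <;> simp [h]

/-- Second-order Taylor remainder of the exponential series. Since `t ≤ 1`, a factor `t ^ 2` comes
out of every remaining term, and `(n + 2)! ≥ n!` leaves an exponential series in `2 * R`, the bound
on the norm of the generator. -/
theorem abs_transitionProb_sub_le (M : JumpChain S E) {R : ℝ} (hR0 : 0 ≤ R)
    (hR : ∀ x, ∑ e, (M.rate x e : ℝ) ≤ R) {t : ℝ} (ht : 0 ≤ t) (ht1 : t ≤ 1) (x y : S) :
    |M.transitionProb t x y - Set.indicator {y} 1 x - t * M.generator (Set.indicator {y} 1) x| ≤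
      t ^ 2 * ((2 * R) ^ 2 * Real.exp (2 * R)) := by
  set u : ℕ → ℝ := fun n => t ^ n / (n.factorial : ℝ) * (M.generator^[n] (Set.indicator {y} 1)) x
  have hexp : HasSum (fun n : ℕ => (2 * R) ^ n / (n.factorial : ℝ)) (Real.exp (2 * R)) := by
    rw [Real.exp_eq_exp_ℝ]
    exact NormedSpace.expSeries_div_hasSum_exp (2 * R)
  have hu (n : ℕ) : ‖u (n + 2)‖ ≤
      t ^ 2 * (2 * R) ^ 2 * ((2 * R) ^ n / (n.factorial : ℝ)) := by
    have hg := M.abs_generator_iterate_le hR0 hR (abs_indicator_singleton_le y) (n + 2) x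
    have hfac : (n.factorial : ℝ) ≤ ((n + 2).factorial : ℝ) := by
      exact_mod_cast Nat.factorial_le (by omega)
    have hpos : (0 : ℝ) < n.factorial := by exact_mod_cast n.factorial_pos
    simp only [u, Real.norm_eq_abs, abs_mul]
    rw [abs_of_nonneg (by positivity)]
    calc t ^ (n + 2) / ((n + 2).factorial : ℝ) * |(M.generator^[n + 2] (Set.indicator {y} 1)) x|
        ≤ t ^ 2 / (n.factorial : ℝ) * (2 * R) ^ (n + 2) := by
          refine mul_le_mul (div_le_div₀ (by positivity) ?_ hpos hfac) hg (abs_nonneg _)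
            (by positivity)
          exact pow_le_pow_of_le_one ht ht1 (by omega)
      _ = _ := by rw [pow_add]; ring
  have hs := hexp.mul_left (t ^ 2 * (2 * R) ^ 2)
  have hsu : Summable u := (summable_nat_add_iff 2).1 (Summable.of_norm_bounded hs.summable hu)
  have hsplit : M.transitionProb t x y - Set.indicator {y} 1 x
      - t * M.generator (Set.indicator {y} 1) x = ∑' n, u (n + 2) := by
    have h := hsu.sum_add_tsum_nat_add 2
    have h2 : M.transitionProb t x y = ∑' n, u n := rfl
    have h01 : ∑ i ∈ Finset.range 2, u i =
        Set.indicator {y} 1 x + t * M.generator (Set.indicator {y} 1) x := by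
      simp [Finset.sum_range_succ, u]
    rw [h2, ← h, h01]
    ring
  rw [hsplit, ← mul_assoc]
  exact tsum_of_norm_bounded hs hu

/-- Differentiation of `π P_t = π` at `t = 0`: the zeroth-order terms cancel, and the remainder is
`O(t ^ 2)` uniformly in the starting state, so division by `t` and `t → 0` give the claim. -/
theorem IsStationary.tsum_generator_indicator_eq_zero {M : JumpChain S E} {π : PMF S}
    (hπ : M.IsStationary π) {R : ℝ} (hR0 : 0 ≤ R) (hR : ∀ x, ∑ e, (M.rate x e : ℝ) ≤ R) (y : S) :
    ∑' x, (π x).toReal * M.generator (Set.indicator {y} 1) x = 0 := by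
  set a := ∑' x, (π x).toReal * M.generator (Set.indicator {y} 1) x with ha
  set C := (2 * R) ^ 2 * Real.exp (2 * R)
  have hC : 0 ≤ C := by positivity
  have hg0 := abs_indicator_singleton_le y
  have hg1 := M.abs_generator_le hR zero_le_one hg0
  have key (t : ℝ) (ht : 0 < t) (ht1 : t ≤ 1) : |a| ≤ t * C := by
    have hrem := fun x => M.abs_transitionProb_sub_le hR0 hR ht.le ht1 x y
    have hs0 := π.summable_toReal_mul hg0
    have hs1 := π.summable_toReal_mul hg1
    have hsr := π.summable_toReal_mul hrem
    have heq : ∑' x, (π x).toReal * M.transitionProb t x y =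
        (π y).toReal + t * a + ∑' x, (π x).toReal * (M.transitionProb t x y -
          Set.indicator {y} 1 x - t * M.generator (Set.indicator {y} 1) x) := by
      have h0 : ∑' x, (π x).toReal * Set.indicator {y} (1 : S → ℝ) x = (π y).toReal := by
        rw [tsum_eq_single y]
        · simp
        · intro b hb
          simp [hb]
      rw [← h0, ha, ← tsum_mul_left, ← hs0.tsum_add (hs1.mul_left t),
        ← (hs0.add (hs1.mul_left t)).tsum_add hsr]
      exact tsum_congr fun x => by ring
    rw [hπ t ht.le y] at heq
    have hb := π.abs_tsum_toReal_mul_le hrem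
    have : t * |a| ≤ t * (t * C) := by
      rw [← abs_of_pos ht, ← abs_mul, abs_of_pos ht]
      rw [show t * a = -∑' x, (π x).toReal * (M.transitionProb t x y -
          Set.indicator {y} 1 x - t * M.generator (Set.indicator {y} 1) x) by linarith, abs_neg]
      exact hb.trans (le_of_eq (by ring))
    exact le_of_mul_le_mul_left this ht
  have hlim : Filter.Tendsto (fun t : ℝ => t * C) (𝓝[>] 0) (𝓝 0) := by
    have : Filter.Tendsto (fun t : ℝ => t * C) (𝓝 0) (𝓝 (0 * C)) :=
      (continuous_id.mul continuous_const).tendsto 0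
    rw [zero_mul] at this
    exact this.mono_left nhdsWithin_le_nhds
  have : |a| ≤ 0 := ge_of_tendsto hlim <| by
    filter_upwards [Ioc_mem_nhdsGT (zero_lt_one' ℝ)] with t ht
    exact key t ht.1 ht.2
  exact abs_nonpos_iff.1 this

theorem hasSum_mul_generator_indicator (M : JumpChain S E) (f : S → ℝ) (x : S) :
    HasSum (fun y => f y * M.generator (Set.indicator {y} 1) x) (M.generator f x) := by
  have h (z : S) : HasSum (fun y => f y * Set.indicator {y} (1 : S → ℝ) z) (f z) := by
    convert hasSum_single z ?_ using 1
    · simp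
    · intro y hy
      simp [hy.symm]
  have := hasSum_sum (s := Finset.univ) fun e _ =>
    ((h (M.jump x e)).sub (h x)).mul_left (M.rate x e : ℝ)
  refine HasSum.congr_fun this fun y => ?_
  simp only [generator]
  rw [Finset.mul_sum]
  exact Finset.sum_congr rfl fun e _ => by ring

/-- Absolute summability that justifies exchanging the sums when `f` is expanded in indicators of
points. -/
theorem summable_mul_generator_indicator (M : JumpChain S E) (π : PMF S) {R : ℝ}
    (hR : ∀ x, ∑ e, (M.rate x e : ℝ) ≤ R) {f : S → ℝ} {C : ℝ} (hC : 0 ≤ C) (hf : ∀ x, |f x| ≤ C) :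
    Summable fun p : S × S =>
      (π p.1).toReal * (f p.2 * M.generator (Set.indicator {p.2} 1) p.1) := by
  have hind (z : S) : HasSum (fun y => Set.indicator {y} (1 : S → ℝ) z) 1 := by
    convert hasSum_single z ?_ using 1
    · simp
    · intro y hy
      simp [hy.symm]
  have hnn (x y : S) : 0 ≤ Set.indicator {y} (1 : S → ℝ) x :=
    Set.indicator_nonneg (fun _ _ => zero_le_one) x
  -- Dominating function: the difference of indicators is replaced by their sum, whose total over
  -- `y` is `2` for each transition.
  let G : S × S → ℝ := fun p => (π p.1).toReal * (C * ∑ e, (M.rate p.1 e : ℝ) *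
    (Set.indicator {p.2} 1 (M.jump p.1 e) + Set.indicator {p.2} 1 p.1))
  have hGsum (x : S) : HasSum (fun y => G (x, y))
      ((π x).toReal * (C * ∑ e, (M.rate x e : ℝ) * (1 + 1))) := by
    have h (e : E) : HasSum (fun y => (M.rate x e : ℝ) * (Set.indicator {y} (1 : S → ℝ) (M.jump x e)
        + Set.indicator {y} (1 : S → ℝ) x)) ((M.rate x e : ℝ) * (1 + 1)) :=
      ((hind (M.jump x e)).add (hind x)).mul_left _
    exact ((hasSum_sum (s := Finset.univ) fun e _ => h e).mul_left C).mul_left (π x).toReal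
  have hG0 (p : S × S) : 0 ≤ G p := by
    refine mul_nonneg ENNReal.toReal_nonneg (mul_nonneg hC (Finset.sum_nonneg fun e _ => ?_))
    exact mul_nonneg (NNReal.coe_nonneg _) (add_nonneg (hnn _ _) (hnn _ _))
  have hGs : Summable G := by
    rw [summable_prod_of_nonneg hG0]
    refine ⟨fun x => (hGsum x).summable, ?_⟩
    rw [funext fun x => (hGsum x).tsum_eq]
    refine π.summable_toReal_mul (C := C * (R * 2)) fun x => ?_
    have h0 : 0 ≤ ∑ e, (M.rate x e : ℝ) := Finset.sum_nonneg fun e _ => NNReal.coe_nonneg _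
    rw [← Finset.sum_mul, abs_of_nonneg (by positivity)]
    refine mul_le_mul_of_nonneg_left ?_ hC
    have := hR x
    linarith
  refine Summable.of_norm_bounded hGs fun p => ?_
  rw [Real.norm_eq_abs, abs_mul, abs_of_nonneg ENNReal.toReal_nonneg, abs_mul]
  refine mul_le_mul_of_nonneg_left ?_ ENNReal.toReal_nonneg
  refine mul_le_mul (hf _) ?_ (abs_nonneg _) hC
  refine (Finset.abs_sum_le_sum_abs _ _).trans (Finset.sum_le_sum fun e _ => ?_)
  rw [abs_mul, abs_of_nonneg (NNReal.coe_nonneg _)]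
  refine mul_le_mul_of_nonneg_left ?_ (NNReal.coe_nonneg _)
  have h₁ := hnn (M.jump p.1 e) p.2
  have h₂ := hnn p.1 p.2
  exact abs_le.2 ⟨by linarith, by linarith⟩

theorem IsStationary.tsum_generator_eq_zero {M : JumpChain S E} {π : PMF S}
    (hπ : M.IsStationary π) {R : ℝ} (hR0 : 0 ≤ R) (hR : ∀ x, ∑ e, (M.rate x e : ℝ) ≤ R)
    {f : S → ℝ} {C : ℝ} (hC : 0 ≤ C) (hf : ∀ x, |f x| ≤ C) :
    ∑' x, (π x).toReal * M.generator f x = 0 := by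
  calc ∑' x, (π x).toReal * M.generator f x = ∑' x, ∑' y, (π x).toReal *
          (f y * M.generator (Set.indicator {y} 1) x) := by
        refine tsum_congr fun x => ?_
        rw [← ((M.hasSum_mul_generator_indicator f x).mul_left (π x).toReal).tsum_eq]
    _ = ∑' y, ∑' x, (π x).toReal * (f y * M.generator (Set.indicator {y} 1) x) :=
        (M.summable_mul_generator_indicator π hR hC hf).tsum_comm.symm
    _ = ∑' y, f y * ∑' x, (π x).toReal * M.generator (Set.indicator {y} 1) x := by
        refine tsum_congr fun y => ?_
        rw [← tsum_mul_left]
        exact tsum_congr fun x => by ring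
    _ = 0 := by simp only [hπ.tsum_generator_indicator_eq_zero hR0 hR, mul_zero, tsum_zero]

/-- The exponential of a function whose increments are at most `1` inherits its drift. -/
theorem generator_exp_le (M : JumpChain S E) {V : S → ℝ} {θ : ℝ} (hθ : 0 ≤ θ) (hθ1 : θ ≤ 1) {x : S}
    (hV : ∀ e, M.rate x e ≠ 0 → |V (M.jump x e) - V x| ≤ 1) :
    M.generator (fun z => Real.exp (-(θ * V z))) x ≤
      Real.exp (-(θ * V x)) * (-θ * M.generator V x + θ ^ 2 * ∑ e, (M.rate x e : ℝ)) := by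
  simp only [generator]
  rw [Finset.mul_sum, Finset.mul_sum, ← Finset.sum_add_distrib, Finset.mul_sum]
  refine Finset.sum_le_sum fun e _ => ?_
  by_cases he : M.rate x e = 0
  · simp [he]
  set d := V (M.jump x e) - V x with hd
  have hd1 := hV e he
  have hexp : Real.exp (-(θ * V (M.jump x e))) = Real.exp (-(θ * V x)) * Real.exp (-(θ * d)) := by
    rw [← Real.exp_add]; congr 1; rw [hd]; ring
  have hθd : |-(θ * d)| ≤ 1 := by
    rw [abs_neg, abs_mul, abs_of_nonneg hθ]; nlinarith [abs_nonneg d]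
  -- `exp u ≤ 1 + u + u ^ 2` for `|u| ≤ 1`, with `u = -(θ * d)`.
  have hb := (abs_le.1 (Real.abs_exp_sub_one_sub_id_le hθd)).2
  have hd2 : d ^ 2 ≤ 1 := by
    rw [← sq_abs]; nlinarith [abs_nonneg d]
  have hb' : Real.exp (-(θ * d)) - 1 ≤ -θ * d + θ ^ 2 := by nlinarith [sq_nonneg θ]
  have hpos := mul_nonneg (M.rate x e).coe_nonneg (Real.exp_pos (-(θ * V x))).le
  have := mul_le_mul_of_nonneg_left hb' hpos
  rw [hexp]
  nlinarith

end JumpChain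

/-! ### Server indicators, their sums over the system, and the dispatcher's choices. -/

namespace TABS

namespace Server

/-- The indicator of being busy. -/
def busyInd : Server → ℝ
  | on (_ + 1) => 1
  | _ => 0

/-- The indicator of being idle-on. -/
def idleInd : Server → ℝ
  | on 0 => 1
  | _ => 0

/-- The indicator of being in setup mode. -/
def setupInd : Server → ℝ
  | setup => 1
  | _ => 0

theorem idleInd_nonneg (s : Server) : 0 ≤ s.idleInd := by
  rcases s with _ | _ | _ | n <;> simp [idleInd]

theorem setupInd_le_one (s : Server) : s.setupInd ≤ 1 := by
  rcases s with _ | _ | _ | n <;> simp [setupInd]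

theorem busyInd_addTask {s : Server} (hs : s ≠ on 0) : s.addTask.busyInd = s.busyInd := by
  rcases s with _ | _ | _ | n <;> simp_all [addTask, busyInd]

theorem idleInd_addTask {s : Server} (hs : s ≠ on 0) : s.addTask.idleInd = s.idleInd := by
  rcases s with _ | _ | _ | n <;> simp_all [addTask, idleInd]

theorem setupInd_addTask {s : Server} (hs : s ≠ on 0) : s.addTask.setupInd = s.setupInd := by
  rcases s with _ | _ | _ | n <;> simp_all [addTask, setupInd]

theorem ownRate_le (μ ν : ℝ≥0) (s : Server) : (s.ownRate μ ν : ℝ) ≤ 1 + μ + ν := by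
  have := μ.coe_nonneg
  have := ν.coe_nonneg
  rcases s with _ | _ | _ | n <;> simp [ownRate] <;> linarith

end Server

open Server

variable {N : ℕ} {K : Finset (Fin N)}

/-- The sum of `w` over the states of the servers with finite queues. -/
def total (w : Server → ℝ) (x : State K) : ℝ := ∑ i, w (x i)

theorem total_update (w : Server → ℝ) (x : State K) (i : {i : Fin N // i ∉ K}) (s : Server) :
    total w (Function.update x i s) = total w x + (w s - w (x i)) := by
  have h (y : State K) : total w y = w (y i) + ∑ j ∈ Finset.univ.erase i, w (y j) :=
    (Finset.add_sum_erase _ _ (Finset.mem_univ i)).symm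
  rw [h, h x, Function.update_self, Finset.sum_congr rfl fun j hj => by
    rw [Function.update_of_ne (Finset.ne_of_mem_erase hj)]]
  ring

theorem total_idleInd_nonneg (x : State K) : 0 ≤ total idleInd x :=
  Finset.sum_nonneg fun _ _ => idleInd_nonneg _

theorem card_finite_queues : (Fintype.card {i : Fin N // i ∉ K} : ℝ) + K.card = N := by
  rw [Fintype.card_subtype_compl, Fintype.card_coe, Fintype.card_fin,
    Nat.cast_sub (by simpa using K.card_le_univ)]
  ring

theorem total_setupInd_le (x : State K) : total setupInd x ≤ N := by
  have h : total setupInd x ≤ ∑ _ : {i : Fin N // i ∉ K}, (1 : ℝ) :=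
    Finset.sum_le_sum fun _ _ => setupInd_le_one _
  have := card_finite_queues (K := K)
  rw [Finset.sum_const, Finset.card_univ, nsmul_eq_mul, mul_one] at h
  linarith [(Nat.cast_nonneg K.card : (0 : ℝ) ≤ K.card)]

theorem Q_one_eq (x : State K) : (Q x 1 : ℝ) = K.card + total busyInd x := by
  classical
  have h1 : (Q x 1 : ℝ) = ∑ j : Fin N, if (1 : ℕ∞) ≤ queueLength x j then (1 : ℝ) else 0 := by
    rw [Finset.sum_boole, Q]
    norm_cast
  rw [h1, ← Fintype.sum_subtype_add_sum_subtype (fun j => j ∈ K)]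
  congr 1
  · rw [Finset.sum_congr rfl fun (j : {j // j ∈ K}) _ => if_pos (by simp [queueLength, j.2])]
    simp
  · refine Finset.sum_congr rfl fun j _ => ?_
    rw [queueLength, dif_neg j.2]
    generalize x ⟨j, j.2⟩ = s
    rcases s with _ | _ | _ | n <;> simp [tasks, busyInd]

theorem idleOn_eq_empty_iff (x : State K) : idleOn x = ∅ ↔ ∀ i, x i ≠ on 0 := by
  simp only [idleOn, Finset.filter_eq_empty_iff, Finset.mem_univ, true_imp_iff, not_exists,
    Subtype.forall]

theorem idleOff_eq_empty_iff (x : State K) : idleOff x = ∅ ↔ ∀ i, x i ≠ off := by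
  simp only [idleOff, Finset.filter_eq_empty_iff, Finset.mem_univ, true_imp_iff, not_exists,
    Subtype.forall]

theorem sum_uniformPick (A : Finset (Fin N)) : ∑ o, uniformPick A o = 1 := by
  rw [Fintype.sum_option]
  rcases A.eq_empty_or_nonempty with rfl | hA
  · simp [uniformPick]
  · have : (A.card : ℝ≥0) ≠ 0 := by exact_mod_cast hA.card_pos.ne'
    simp [uniformPick, hA.ne_empty, Finset.sum_ite_mem, this]

theorem uniformPick_ne_zero {A : Finset (Fin N)} {o : Option (Fin N)} (h : uniformPick A o ≠ 0) :
    (o = none ∧ A = ∅) ∨ ∃ i ∈ A, o = some i := by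
  rcases o with _ | i
  · left
    simpa [uniformPick] using h
  · right
    by_contra! hc
    exact h (if_neg fun hi => hc i hi rfl)

/-! ### The potential and its increments. -/

/-- The number of busy servers, corrected by the number of idle-on servers (truncated at `m`) and
the number of servers in setup mode. -/
def potential (a m d : ℝ) (x : State K) : ℝ :=
  K.card + total busyInd x + a * min (total idleInd x) m + d * total setupInd x

theorem potential_update_sub (a m d : ℝ) (x : State K) (i : {i : Fin N // i ∉ K}) (s : Server) :
    potential a m d (Function.update x i s) - potential a m d x =
      (s.busyInd - (x i).busyInd) +
        a * (min (total idleInd x + (s.idleInd - (x i).idleInd)) m - min (total idleInd x) m) +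
        d * (s.setupInd - (x i).setupInd) := by
  simp only [potential, total_update]
  ring

theorem min_add_one_sub (I m : ℝ) : 0 ≤ min (I + 1) m - min I m ∧ min (I + 1) m - min I m ≤ 1 := by
  rcases min_cases (I + 1) m with h | h <;> rcases min_cases I m with h' | h' <;>
    constructor <;> linarith

theorem min_sub_one_sub (I m : ℝ) :
    -1 ≤ min (I + -1) m - min I m ∧ min (I + -1) m - min I m ≤ 0 := by
  rcases min_cases (I + -1) m with h | h <;> rcases min_cases I m with h' | h' <;>
    constructor <;> linarith

theorem arrive_some_none (x : State K) (j : Fin N) (hj : j ∉ K) (h : x ⟨j, hj⟩ = on 0) :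
    arrive x (some j) none = Function.update x ⟨j, hj⟩ (on 1) := by
  funext i
  by_cases hi : i = ⟨j, hj⟩
  · subst hi
    simp [arrive, h, addTask]
  · have : j ≠ i.1 := fun e => hi (Subtype.ext e.symm)
    simp [arrive, hi, this]

theorem total_arrive_none {w : Server → ℝ} {x : State K} (hx : ∀ i, x i ≠ on 0)
    (hw : ∀ s, s ≠ on 0 → w s.addTask = w s) (b : Option (Fin N)) :
    total w (arrive x b none) = total w x := by
  refine Finset.sum_congr rfl fun i _ => ?_
  by_cases hb : b = some i.1
  · simp [arrive, hb, hw _ (hx i)]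
  · simp [arrive, hb]

theorem total_arrive_some {w : Server → ℝ} {x : State K} (hx : ∀ i, x i ≠ on 0)
    (hw : ∀ s, s ≠ on 0 → w s.addTask = w s) (b : Option (Fin N)) (j : Fin N) (hj : j ∉ K) :
    total w (arrive x b (some j)) = total w (Function.update x ⟨j, hj⟩ setup) := by
  refine Finset.sum_congr rfl fun i _ => ?_
  by_cases hi : i = ⟨j, hj⟩
  · subst hi
    simp [arrive]
  · have : j ≠ i.1 := fun e => hi (Subtype.ext e.symm)
    rw [Function.update_of_ne hi]
    by_cases hb : b = some i.1
    · simp [arrive, hb, hw _ (hx i), this]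
    · simp [arrive, hb, this]

/-- If some server is idle-on, then an arriving task makes it busy. -/
theorem potential_arrive_of_idleOn {a m d : ℝ} (ha : 0 ≤ a) {x : State K} (hI : idleOn x ≠ ∅)
    {b c : Option (Fin N)} (hb : uniformPick (receivers x) b ≠ 0)
    (hc : uniformPick (setupCandidates x) c ≠ 0) :
    1 - a ≤ potential a m d (arrive x b c) - potential a m d x ∧
      potential a m d (arrive x b c) - potential a m d x ≤ 1 := by
  simp only [receivers, setupCandidates, if_neg hI] at hb hc
  obtain rfl : c = none := by
    rcases uniformPick_ne_zero hc with h | ⟨i, hi, -⟩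
    · exact h.1
    · simp at hi
  obtain ⟨j, hj, rfl⟩ : ∃ j ∈ idleOn x, b = some j := by
    rcases uniformPick_ne_zero hb with h | h
    · exact absurd h.2 hI
    · exact h
  obtain ⟨hjK, hxj⟩ : ∃ h : j ∉ K, x ⟨j, h⟩ = on 0 := by simpa [idleOn] using hj
  rw [arrive_some_none x j hjK hxj, potential_update_sub, hxj]
  simp only [busyInd, idleInd, setupInd, sub_zero, zero_sub, mul_zero, add_zero]
  have := min_sub_one_sub (total idleInd x) m
  constructor <;> nlinarith

/-- With no idle-on server, the assigned task changes none of the three indicators, so only the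
start of a setup is felt. -/
theorem potential_arrive_of_not_idleOn {a m d : ℝ} {x : State K} (hI : idleOn x = ∅)
    {b c : Option (Fin N)} (hc : uniformPick (setupCandidates x) c ≠ 0) :
    potential a m d (arrive x b c) - potential a m d x = if idleOff x = ∅ then 0 else d := by
  simp only [setupCandidates, if_pos hI] at hc
  have hx := (idleOn_eq_empty_iff x).1 hI
  rcases uniformPick_ne_zero hc with ⟨rfl, h⟩ | ⟨j, hj, rfl⟩
  · rw [if_pos h]
    simp only [potential, total_arrive_none hx fun _ => busyInd_addTask,
      total_arrive_none hx fun _ => idleInd_addTask,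
      total_arrive_none hx fun _ => setupInd_addTask, sub_self]
  · rw [if_neg (Finset.ne_empty_of_mem hj)]
    obtain ⟨hjK, hxj⟩ : ∃ h : j ∉ K, x ⟨j, h⟩ = off := by simpa [idleOff] using hj
    have h : potential a m d (arrive x b (some j)) =
        potential a m d (Function.update x ⟨j, hjK⟩ setup) := by
      simp only [potential, total_arrive_some hx (fun _ => busyInd_addTask) b j hjK,
        total_arrive_some hx (fun _ => idleInd_addTask) b j hjK,
        total_arrive_some hx (fun _ => setupInd_addTask) b j hjK]
    rw [h, potential_update_sub, hxj]
    simp [busyInd, idleInd, setupInd]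

theorem abs_potential_own_le {a m d : ℝ} (ha : 0 ≤ a) (ha1 : a ≤ 1) (hd : 0 ≤ d) (hd1 : d ≤ 1)
    (x : State K) (i : {i : Fin N // i ∉ K}) :
    |potential a m d (Function.update x i (x i).next) - potential a m d x| ≤ 1 := by
  have h₁ := min_sub_one_sub (total idleInd x) m
  have h₂ := min_add_one_sub (total idleInd x) m
  rw [potential_update_sub, abs_le]
  rcases x i with _ | _ | _ | _ | n <;>
    simp only [next, busyInd, idleInd, setupInd, sub_self, sub_zero, zero_sub, mul_zero, add_zero,
      zero_add] <;> constructor <;> nlinarith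

theorem abs_potential_jump_le {lam μ ν : ℝ≥0} {a m d : ℝ} (ha : 0 ≤ a) (ha1 : a ≤ 1) (hd : 0 ≤ d)
    (hd1 : d ≤ 1) (x : State K) (e : Event K) (he : (chain lam μ ν K).rate x e ≠ 0) :
    |potential a m d ((chain lam μ ν K).jump x e) - potential a m d x| ≤ 1 := by
  rcases e with ⟨b, c⟩ | i
  · simp only [chain, ne_eq, mul_eq_zero, not_or] at he ⊢
    by_cases hI : idleOn x = ∅
    · rw [potential_arrive_of_not_idleOn hI he.2.2]
      split_ifs
      · simp
      · rwa [abs_of_nonneg hd]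
    · have := potential_arrive_of_idleOn (m := m) (d := d) ha hI he.2.1 he.2.2
      exact abs_le.2 ⟨by linarith, this.2⟩
  · exact abs_potential_own_le ha ha1 hd hd1 x i

theorem sum_rate_le (lam μ ν : ℝ≥0) (x : State K) :
    ∑ e, ((chain lam μ ν K).rate x e : ℝ) ≤ (lam + 1 + μ + ν) * N := by
  have h₁ : ∑ b, ∑ c, (lam * (N : ℝ≥0) *
      (uniformPick (receivers x) b * uniformPick (setupCandidates x) c)) = lam * N := by
    simp_rw [← Finset.mul_sum]
    rw [← Finset.sum_mul, sum_uniformPick, sum_uniformPick, one_mul, mul_one]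
  have h₂ : ∑ i, ((x i).ownRate μ ν : ℝ) ≤ ∑ _ : {i : Fin N // i ∉ K}, (1 + μ + ν : ℝ) :=
    Finset.sum_le_sum fun i _ => ownRate_le μ ν (x i)
  rw [Fintype.sum_sum_type, Fintype.sum_prod_type]
  have h₁' := congrArg ((↑) : ℝ≥0 → ℝ) h₁
  push_cast at h₁'
  simp only [chain]
  push_cast
  rw [h₁']
  rw [Finset.sum_const, Finset.card_univ, nsmul_eq_mul] at h₂
  have h₃ : (Fintype.card {i : Fin N // i ∉ K} : ℝ) ≤ N := by
    have := card_finite_queues (K := K)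
    linarith [(Nat.cast_nonneg K.card : (0 : ℝ) ≤ K.card)]
  have h₄ : (0 : ℝ) ≤ 1 + μ + ν := by positivity
  nlinarith

/-! ### Drift of the potential. -/

/-- The drift of the potential, split into arrivals and the servers' own transitions. -/
theorem generator_potential_ge {lam μ ν : ℝ≥0} {a m d D : ℝ} {x : State K}
    (h : ∀ b c, uniformPick (receivers x) b ≠ 0 → uniformPick (setupCandidates x) c ≠ 0 →
      D ≤ potential a m d (arrive x b c) - potential a m d x) :
    lam * N * D + ∑ i, ((x i).ownRate μ ν : ℝ) *
      (potential a m d (Function.update x i (x i).next) - potential a m d x) ≤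
        (chain lam μ ν K).generator (potential a m d) x := by
  have h₁ : ∑ b, ∑ c, (lam * (N : ℝ≥0) *
      (uniformPick (receivers x) b * uniformPick (setupCandidates x) c)) = lam * N := by
    simp_rw [← Finset.mul_sum]
    rw [← Finset.sum_mul, sum_uniformPick, sum_uniformPick, one_mul, mul_one]
  have h₁' := congrArg ((↑) : ℝ≥0 → ℝ) h₁
  push_cast at h₁'
  rw [JumpChain.generator, Fintype.sum_sum_type, Fintype.sum_prod_type, ← h₁', Finset.sum_mul]
  simp_rw [Finset.sum_mul]
  refine add_le_add (Finset.sum_le_sum fun b _ => Finset.sum_le_sum fun c _ => ?_) le_rfl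
  simp only [chain]
  push_cast
  by_cases hb : uniformPick (receivers x) b = 0
  · simp [hb]
  by_cases hc : uniformPick (setupCandidates x) c = 0
  · simp [hc]
  exact mul_le_mul_of_nonneg_left (h b c hb hc) (by positivity)

/-- This is where the truncation at `m` pays off: without it, standby expirations could cost `a * μ
* I` with `I` of order `N`, which the arrivals need not compensate. -/
theorem own_drift_ge (μ ν : ℝ≥0) {a m d : ℝ} (ha : 0 ≤ a) (ha1 : a ≤ 1) (hd : 0 ≤ d) (hm : 0 ≤ m)
    (x : State K) :
    -(d * ν * N) - μ * (m + 1) - total busyInd x ≤ ∑ i, ((x i).ownRate μ ν : ℝ) *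
      (potential a m d (Function.update x i (x i).next) - potential a m d x) := by
  set I := total idleInd x with hI
  -- Effective cost per idle-on server: once `I ≥ m + 1`, losing one leaves `min I m` equal to `m`.
  set r : ℝ := if I < m + 1 then μ else 0 with hr
  have h₁ := min_sub_one_sub I m
  have h₂ := min_add_one_sub I m
  have hterm (i : {i : Fin N // i ∉ K}) :
      -(d * ν) * (x i).setupInd - r * (x i).idleInd - (x i).busyInd ≤ ((x i).ownRate μ ν : ℝ) *
        (potential a m d (Function.update x i (x i).next) - potential a m d x) := by
    have hν := ν.coe_nonneg
    have hμ := μ.coe_nonneg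
    rw [potential_update_sub, ← hI]
    rcases x i with _ | _ | _ | _ | n <;>
      simp only [next, ownRate, busyInd, idleInd, setupInd, sub_self, sub_zero, zero_sub, mul_zero,
        add_zero, zero_add, mul_one, NNReal.coe_zero, NNReal.coe_one, one_mul, le_refl]
    · nlinarith [mul_nonneg hν (mul_nonneg ha h₂.1)]
    · rw [hr]
      split_ifs with hlt
      · nlinarith [mul_nonneg hμ (mul_nonneg ha (neg_le_iff_add_nonneg.1 h₁.1))]
      · rw [min_eq_right (by linarith), min_eq_right (by linarith)]
        simp
    · nlinarith [mul_nonneg ha h₂.1]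
    · linarith
  refine le_trans ?_ (Finset.sum_le_sum fun i _ => hterm i)
  rw [Finset.sum_sub_distrib, Finset.sum_sub_distrib, ← Finset.mul_sum, ← Finset.mul_sum]
  change _ ≤ -(d * ν) * total setupInd x - r * I - total busyInd x
  have hU : d * ν * total setupInd x ≤ d * ν * N :=
    mul_le_mul_of_nonneg_left (total_setupInd_le x) (by positivity)
  have hrI : r * I ≤ μ * (m + 1) := by
    rw [hr]
    split_ifs with hlt
    · exact mul_le_mul_of_nonneg_left hlt.le μ.coe_nonneg
    · rw [zero_mul]; positivity
  linarith

/-- Here `I = 0`, and `m ≥ 1` makes a new idle-on server count in full. A server that empties thus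
costs only `1 - a`, and a completed setup yields `a - d`. -/
theorem own_drift_ge_of_not_idleOn (μ ν : ℝ≥0) {a m d : ℝ} (hm : 1 ≤ m) {x : State K}
    (hx : ∀ i, x i ≠ on 0) (ha1 : a ≤ 1) :
    ν * (a - d) * total setupInd x - (1 - a) * total busyInd x ≤ ∑ i, ((x i).ownRate μ ν : ℝ) *
      (potential a m d (Function.update x i (x i).next) - potential a m d x) := by
  have hI : total idleInd x = 0 := Finset.sum_eq_zero fun i _ => by
    have := hx i
    generalize x i = s at this
    rcases s with _ | _ | _ | n <;> simp_all [idleInd]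
  have h0 : min (0 : ℝ) m = 0 := min_eq_left (by linarith)
  have h1 : min (1 : ℝ) m = 1 := min_eq_left hm
  simp only [total]
  rw [Finset.mul_sum, Finset.mul_sum, ← Finset.sum_sub_distrib]
  refine Finset.sum_le_sum fun i _ => ?_
  have := hx i
  rw [potential_update_sub, hI]
  generalize x i = s at this
  rcases s with _ | _ | _ | _ | n
  · simp [next, ownRate, busyInd, idleInd, setupInd]
  · simp only [next, ownRate, busyInd, idleInd, setupInd, zero_add, sub_zero, h0, h1]
    linarith
  · simp at this
  · simp only [next, ownRate, busyInd, idleInd, setupInd, zero_add, sub_zero, h0, h1,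
      NNReal.coe_one]
    linarith
  · simp only [next, ownRate, busyInd, idleInd, setupInd, zero_add, sub_self, h0,
      NNReal.coe_one]
    linarith

theorem total_busyInd_add_setupInd {x : State K} (hx : ∀ i, x i ≠ on 0) (hx' : ∀ i, x i ≠ off) :
    K.card + total busyInd x + total setupInd x = N := by
  have h : total busyInd x + total setupInd x = ∑ _ : {i : Fin N // i ∉ K}, (1 : ℝ) := by
    rw [total, total, ← Finset.sum_add_distrib]
    refine Finset.sum_congr rfl fun i _ => ?_
    have h₁ := hx i
    have h₂ := hx' i
    generalize x i = s at h₁ h₂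
    rcases s with _ | _ | _ | n <;> simp_all [busyInd, setupInd]
  rw [Finset.sum_const, Finset.card_univ, nsmul_eq_mul, mul_one] at h
  linarith [card_finite_queues (K := K)]

end TABS

/-! ### Positive drift when few servers are busy, and the exponential bound. -/

namespace TABS

open Server

variable {N : ℕ} {K : Finset (Fin N)}

/-- As long as less than a fraction `β` of the servers is busy, the potential has a positive drift
of order `N`. -/
theorem generator_potential_ge_of_few_busy {lam μ ν : ℝ≥0} (hlam1 : lam < 1) {β : ℝ} (hβ : 0 < β)
    (hβν : β ≤ ν) (hβ' : 48 * ((1 + μ + ν) * β) ≤ (lam : ℝ) ^ 2) (hN : 6 ≤ β * N)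
    (hNμ : 48 * (μ : ℝ) ≤ (lam : ℝ) ^ 2 * N) {x : State K} (hx : (Q x 1 : ℝ) < β * N) :
    lam * β / 12 * N ≤
      (chain lam μ ν K).generator (potential (1 - lam / 12) (β / 6 * N) (β / 6)) x := by
  have hl1 : (lam : ℝ) < 1 := by exact_mod_cast hlam1
  have hl0 := lam.coe_nonneg
  have hμ0 := μ.coe_nonneg
  have hν0 := ν.coe_nonneg
  have hK0 : (0 : ℝ) ≤ K.card := Nat.cast_nonneg _
  have hN0 : (0 : ℝ) ≤ N := Nat.cast_nonneg _
  have hl2 : (lam : ℝ) ^ 2 ≤ lam := by nlinarith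
  have hβs : 48 * β ≤ (lam : ℝ) ^ 2 := by
    nlinarith [mul_nonneg hμ0 hβ.le, mul_nonneg hν0 hβ.le]
  have hβμν : (1 + μ + ν) * β * N ≤ (lam : ℝ) ^ 2 / 48 * N :=
    mul_le_mul_of_nonneg_right (by linarith) hN0
  have hβlam : lam * β * N ≤ (lam : ℝ) ^ 2 / 48 * N :=
    mul_le_mul_of_nonneg_right (by nlinarith) hN0
  rw [Q_one_eq] at hx
  have hl2N : 0 ≤ (lam : ℝ) ^ 2 * N := by positivity
  by_cases hI : idleOn x = ∅
  · have hx0 := (idleOn_eq_empty_iff x).1 hI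
    have hdrift := generator_potential_ge (lam := lam) (μ := μ) (ν := ν) (x := x)
      fun b c _ hc => (potential_arrive_of_not_idleOn (a := 1 - lam / 12) (m := β / 6 * N)
        (d := β / 6) (b := b) hI hc).ge
    have hown := own_drift_ge_of_not_idleOn μ ν (a := 1 - lam / 12) (m := β / 6 * N) (d := β / 6)
      (by linarith) hx0 (by linarith)
    refine le_trans ?_ (le_trans (add_le_add le_rfl hown) hdrift)
    have hB : lam / 12 * total busyInd x ≤ lam / 12 * (β * N) :=
      mul_le_mul_of_nonneg_left (by linarith) (by positivity)
    -- With no server off, at least `N / 2` servers are in setup and yield `ν * N / 4`, which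
    -- suffices because `β ≤ ν`. Otherwise arrivals yield `lam * β / 6 * N`, and departures take at
    -- most half of it; this balance fixes `a = 1 - lam / 12` against `d = β / 6`.
    split_ifs with hO
    · have hsum := total_busyInd_add_setupInd hx0 ((idleOff_eq_empty_iff x).1 hO)
      have hU : (N : ℝ) / 2 ≤ total setupInd x := by nlinarith
      have h₁ : ν * (1 / 2) * (N / 2) ≤ ν * (1 - lam / 12 - β / 6) * total setupInd x :=
        mul_le_mul (mul_le_mul_of_nonneg_left (by linarith) hν0) hU (by positivity)
          (mul_nonneg hν0 (by linarith))
      have h₂ : lam * β * N ≤ ν * N :=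
        mul_le_mul_of_nonneg_right (by nlinarith) hN0
      have h₃ : 0 ≤ ν * (N : ℝ) := mul_nonneg hν0 hN0
      linarith
    · have hU : 0 ≤ ν * (1 - lam / 12 - β / 6) * total setupInd x := by
        refine mul_nonneg (mul_nonneg hν0 (by linarith)) (Finset.sum_nonneg fun i _ => ?_)
        generalize x i = s
        rcases s with _ | _ | _ | n <;> simp [setupInd]
      linarith
  -- Arrivals yield `lam ^ 2 / 12 * N`. The losses proportional to `β * N` take at most a quarter of
  -- this by `hβ'`, and the leftover `μ` from `m + 1` at most another quarter by `hNμ`.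
  · have hdrift := generator_potential_ge (lam := lam) (μ := μ) (ν := ν) (x := x)
      fun b c hb hc => (potential_arrive_of_idleOn (a := 1 - lam / 12) (m := β / 6 * N)
        (d := β / 6) (by linarith) hI hb hc).1
    have hown := own_drift_ge μ ν (a := 1 - lam / 12) (m := β / 6 * N) (d := β / 6)
      (by linarith) (by linarith) (by linarith) (by positivity) x
    refine le_trans ?_ (le_trans (add_le_add le_rfl hown) hdrift)
    nlinarith [mul_nonneg (mul_nonneg hμ0 hβ.le) hN0, mul_nonneg (mul_nonneg hν0 hβ.le) hN0]

theorem Q_one_le_potential {a m d : ℝ} (ha : 0 ≤ a) (hm : 0 ≤ m) (hd : 0 ≤ d) (x : State K) :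
    (Q x 1 : ℝ) ≤ potential a m d x := by
  have hU : 0 ≤ total setupInd x := Finset.sum_nonneg fun i _ => by
    generalize x i = s
    rcases s with _ | _ | _ | n <;> simp [setupInd]
  have := mul_nonneg ha (le_min (total_idleInd_nonneg x) hm)
  have := mul_nonneg hd hU
  rw [Q_one_eq, potential]
  linarith

/-- With `m = β / 6 * N` and `d = β / 6` the corrections add at most `β / 3 * N`, so `Q₁ < β / 3 *
N` keeps the potential below `2 * β / 3 * N`, well short of `β * N`. -/
theorem potential_le {a m d : ℝ} (ha1 : a ≤ 1) (hm : 0 ≤ m) (hd : 0 ≤ d)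
    (x : State K) : potential a m d x ≤ Q x 1 + m + d * N := by
  have h₁ : a * min (total idleInd x) m ≤ 1 * m :=
    mul_le_mul ha1 (min_le_right _ _) (le_min (total_idleInd_nonneg x) hm) zero_le_one
  have h₂ := mul_le_mul_of_nonneg_left (total_setupInd_le x) hd
  rw [Q_one_eq, potential]
  linarith

/-- Exponential bound for the stationary probability that few servers are busy. -/
theorem toOuterMeasure_q_lt_le {lam μ ν : ℝ≥0} (hlam : 0 < lam) (hlam1 : lam < 1)
    {β : ℝ} (hβ : 0 < β)
    (hβν : β ≤ ν) (hβ' : 48 * ((1 + μ + ν) * β) ≤ (lam : ℝ) ^ 2) (hN : 6 ≤ β * N)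
    (hNμ : 48 * (μ : ℝ) ≤ (lam : ℝ) ^ 2 * N) {c R θ : ℝ} (hc : c = lam * β / 12)
    (hR : R = lam + 1 + μ + ν) (hθ : θ = c / (2 * R))
    {π : PMF (State K)} (hπ : (chain lam μ ν K).IsStationary π) :
    π.toOuterMeasure {x | q x 1 < β / 3} ≤
      ENNReal.ofReal (4 * R / (θ * c) * Real.exp (-(θ * β / 3 * N))) := by
  have hl1 : (lam : ℝ) < 1 := by exact_mod_cast hlam1
  have hl0 : (0 : ℝ) < lam := by exact_mod_cast hlam
  have hμ0 := μ.coe_nonneg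
  have hν0 := ν.coe_nonneg
  have hN0 : (0 : ℝ) < N := by
    by_contra! h
    nlinarith
  have hβ1 : β ≤ 1 := by
    nlinarith [mul_nonneg hμ0 hβ.le, mul_nonneg hν0 hβ.le]
  have hc0 : 0 < c := by rw [hc]; positivity
  have hc1 : c ≤ 1 := by rw [hc]; nlinarith
  have hR1 : 1 ≤ R := by rw [hR]; linarith
  have hθ0 : 0 < θ := by rw [hθ]; positivity
  -- The choice of `θ` makes the second-order term `θ ^ 2 * R * N` exactly half of the drift gain `θ
  -- * c * N`.
  have hθR : θ * R = c / 2 := by rw [hθ]; field_simp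
  have hθ1 : θ ≤ 1 := by nlinarith
  set M := chain lam μ ν K
  set V : State K → ℝ := potential (1 - lam / 12) (β / 6 * N) (β / 6)
  set f : State K → ℝ := fun x => Real.exp (-(θ * V x))
  have hrate (x : State K) : ∑ e, (M.rate x e : ℝ) ≤ R * N := hR ▸ sum_rate_le lam μ ν x
  have hQV (x : State K) : (Q x 1 : ℝ) ≤ V x :=
    Q_one_le_potential (by linarith) (by positivity) (by positivity) x
  have hVQ (x : State K) : V x ≤ Q x 1 + β / 3 * N := by
    have := potential_le (a := 1 - lam / 12) (m := β / 6 * N) (d := β / 6) (by linarith)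
      (by positivity) (by positivity) x
    linarith
  have hjump (x : State K) (e : Event K) (he : M.rate x e ≠ 0) : |V (M.jump x e) - V x| ≤ 1 :=
    abs_potential_jump_le (by linarith) (by linarith) (by linarith) (by linarith) x e he
  have hgen (x : State K) : M.generator f x ≤ f x * (-θ * M.generator V x + θ ^ 2 * (R * N)) := by
    refine (M.generator_exp_le hθ0.le hθ1 (hjump x)).trans ?_
    refine mul_le_mul_of_nonneg_left ?_ (Real.exp_pos _).le
    have := mul_le_mul_of_nonneg_left (hrate x) (sq_nonneg θ)
    linarith
  have hgenV (x : State K) : -(R * N) ≤ M.generator V x := by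
    refine (neg_le_neg (hrate x)).trans ?_
    rw [← Finset.sum_neg_distrib]
    refine Finset.sum_le_sum fun e _ => ?_
    by_cases he : M.rate x e = 0
    · simp [he]
    · nlinarith [(abs_le.1 (hjump x e he)).1, (M.rate x e).coe_nonneg]
  have hfew (x : State K) (hx : (Q x 1 : ℝ) < β * N) :
      M.generator f x ≤ -(θ * c / 2 * N) * f x := by
    have hd : c * N ≤ M.generator V x :=
      hc ▸ generator_potential_ge_of_few_busy hlam1 hβ hβν hβ' hN hNμ hx
    refine (hgen x).trans ?_
    rw [mul_comm _ (f x)]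
    refine mul_le_mul_of_nonneg_left ?_ (Real.exp_pos _).le
    have h₁ := mul_le_mul_of_nonneg_left hd hθ0.le
    have h₂ : θ ^ 2 * (R * N) = θ * c / 2 * N := by
      rw [show θ ^ 2 * (R * N) = θ * (θ * R) * N by ring, hθR]; ring
    linarith
  have hmany (x : State K) (hx : β * N ≤ Q x 1) :
      M.generator f x ≤ 2 * R * N * Real.exp (-(θ * (β * N))) := by
    refine (hgen x).trans ?_
    have h₁ : -θ * M.generator V x + θ ^ 2 * (R * N) ≤ 2 * R * N := by
      have hRN : 0 ≤ R * N := by positivity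
      have h₃ : θ * (R * N) ≤ 1 * (R * N) := mul_le_mul_of_nonneg_right hθ1 hRN
      have h₄ : θ ^ 2 * (R * N) ≤ 1 * (R * N) :=
        mul_le_mul_of_nonneg_right (pow_le_one₀ hθ0.le hθ1) hRN
      linarith [mul_le_mul_of_nonneg_left (hgenV x) hθ0.le]
    have h₂ : f x ≤ Real.exp (-(θ * (β * N))) := Real.exp_le_exp.2 <| by
      have := mul_le_mul_of_nonneg_left (hx.trans (hQV x)) hθ0.le
      linarith
    calc _ ≤ f x * (2 * R * N) := mul_le_mul_of_nonneg_left h₁ (Real.exp_pos _).le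
      _ ≤ Real.exp (-(θ * (β * N))) * (2 * R * N) :=
        mul_le_mul_of_nonneg_right h₂ (by positivity)
      _ = _ := mul_comm _ _
  set A : Set (State K) := {x | q x 1 < β / 3}
  set δ := θ * c / 2 * N * Real.exp (-(θ * (β * N) * (2 / 3)))
  set η := 2 * R * N * Real.exp (-(θ * (β * N)))
  have hδ : 0 < δ := by positivity
  have hη : 0 ≤ η := by positivity
  -- Pointwise form of the balance; averaging over `π` removes the generator and leaves `δ * π(A) ≤
  -- η`.
  have hpt (x : State K) : δ * A.indicator 1 x ≤ η - M.generator f x := by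
    by_cases hxA : x ∈ A
    · have hQ : (Q x 1 : ℝ) < β / 3 * N := by
        have : (Q x 1 : ℝ) / N < β / 3 := hxA
        rwa [div_lt_iff₀ hN0] at this
      have h₁ := hfew x (by nlinarith)
      have h₂ : Real.exp (-(θ * (β * N) * (2 / 3))) ≤ f x := Real.exp_le_exp.2 <| by
        have := mul_le_mul_of_nonneg_left (hVQ x) hθ0.le
        have := mul_le_mul_of_nonneg_left hQ.le hθ0.le
        linarith
      have h₃ : δ ≤ θ * c / 2 * N * f x := mul_le_mul_of_nonneg_left h₂ (by positivity)
      simp only [Set.indicator_of_mem hxA, Pi.one_apply, mul_one]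
      linarith
    · simp only [Set.indicator_of_notMem hxA, mul_zero]
      rcases lt_or_ge (Q x 1 : ℝ) (β * N) with hx | hx
      · have := hfew x hx
        have : 0 ≤ θ * c / 2 * N * f x := mul_nonneg (by positivity) (Real.exp_pos _).le
        linarith
      · linarith [hmany x hx]
  have hf1 (x : State K) : |f x| ≤ 1 := by
    rw [abs_of_nonneg (Real.exp_pos _).le]
    refine Real.exp_le_one_iff.2 (neg_nonpos.2 (mul_nonneg hθ0.le ?_))
    exact (Nat.cast_nonneg _).trans (hQV x)
  have hRN : 0 ≤ R * N := by positivity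
  have hzero := hπ.tsum_generator_eq_zero hRN hrate zero_le_one hf1
  have hsf := π.summable_toReal_mul (M.abs_generator_le hrate zero_le_one hf1)
  have hind (x : State K) : |A.indicator (1 : State K → ℝ) x| ≤ 1 := by
    by_cases h : x ∈ A <;> simp [h]
  have hsA := π.summable_toReal_mul hind
  have hmean : δ * ∑' x, (π x).toReal * A.indicator 1 x ≤ η := by
    have hle : ∑' x, δ * ((π x).toReal * A.indicator 1 x) ≤
        ∑' x, ((π x).toReal * η - (π x).toReal * M.generator f x) := by
      refine (hsA.mul_left δ).tsum_le_tsum (fun x => ?_) ((π.summable_toReal.mul_right η).sub hsf)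
      have := mul_le_mul_of_nonneg_left (hpt x) (ENNReal.toReal_nonneg (a := π x))
      linarith
    rwa [tsum_mul_left, (π.summable_toReal.mul_right η).tsum_sub hsf, hzero, tsum_mul_right,
      π.tsum_toReal, one_mul, sub_zero] at hle
  have hmeas : π.toOuterMeasure A = ENNReal.ofReal (∑' x, (π x).toReal * A.indicator 1 x) := by
    rw [PMF.toOuterMeasure_apply, ENNReal.ofReal_tsum_of_nonneg _ hsA]
    · refine tsum_congr fun x => ?_
      by_cases h : x ∈ A <;> simp [h, π.apply_ne_top x]
    · exact fun x => mul_nonneg ENNReal.toReal_nonneg (Set.indicator_nonneg (by simp) x)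
  rw [hmeas]
  refine ENNReal.ofReal_le_ofReal ?_
  rw [← le_div_iff₀' hδ] at hmean
  refine hmean.trans (le_of_eq ?_)
  rw [div_eq_iff hδ.ne']
  simp only [η, δ]
  rw [show -(θ * (β * N)) = -(θ * β / 3 * N) + -(θ * (β * N) * (2 / 3)) by ring, Real.exp_add]
  field_simp
  ring

end TABS

theorem lemma3p2 (lam μ ν : ℝ≥0) (hlam : 0 < lam) (hlam1 : lam < 1) (hμ : 0 < μ) (hν : 0 < ν) :
    ∃ ε₁ : ℝ, 0 < ε₁ ∧ ∃ C : ℝ, 0 < C ∧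
      ∀ (N : ℕ → ℕ) (K : ∀ n, Finset (Fin (N n))) (κ : ℝ),
        κ ∈ Set.Icc (0 : ℝ) 1 →
        Filter.Tendsto N Filter.atTop Filter.atTop →
        Filter.Tendsto (fun n => ((K n).card : ℝ) / (N n : ℝ)) Filter.atTop (𝓝 κ) →
        (∀ n, TABS.Stable lam μ ν (K n)) →
        ∀ᶠ n in Filter.atTop, ∀ π : PMF (TABS.State (K n)),
          (TABS.chain lam μ ν (K n)).IsStationary π →
            π.toOuterMeasure {x | TABS.q x 1 < ε₁} ≤
              ENNReal.ofReal (Real.exp (-(C * (N n : ℝ)))) := by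
  have hl0 : (0 : ℝ) < lam := by exact_mod_cast hlam
  have hμ0 : (0 : ℝ) < μ := by exact_mod_cast hμ
  have hν0 : (0 : ℝ) < ν := by exact_mod_cast hν
  -- `β ≤ ν` serves the case with neither idle-on nor idle-off servers; the other bound serves
  -- mainly the case with idle-on servers.
  obtain ⟨β, hβ, hβν, hβ'⟩ : ∃ β : ℝ, 0 < β ∧ β ≤ ν ∧ 48 * ((1 + μ + ν) * β) ≤ (lam : ℝ) ^ 2 := by
    refine ⟨min ν ((lam : ℝ) ^ 2 / (48 * (1 + μ + ν))), lt_min hν0 (by positivity),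
      min_le_left _ _, ?_⟩
    have := min_le_right (ν : ℝ) ((lam : ℝ) ^ 2 / (48 * (1 + μ + ν)))
    rw [le_div_iff₀ (by positivity)] at this
    linarith
  set c : ℝ := lam * β / 12 with hc
  set R : ℝ := lam + 1 + μ + ν with hR
  set θ : ℝ := c / (2 * R) with hθ
  have hθ0 : 0 < θ := by positivity
  have hC : 0 < θ * β / 6 := by positivity
  -- Half of the exponent `θ * β / 3` is given up to absorb the constant prefactor for large `N`.
  refine ⟨β / 3, by positivity, θ * β / 6, hC, fun N K κ _ hN _ _ => ?_⟩
  have hNr : Filter.Tendsto (fun n => (N n : ℝ)) Filter.atTop Filter.atTop :=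
    tendsto_natCast_atTop_atTop.comp hN
  have hexp := Real.tendsto_exp_atTop.comp (hNr.const_mul_atTop hC)
  filter_upwards [(hNr.const_mul_atTop hβ).eventually_ge_atTop 6,
    (hNr.const_mul_atTop (pow_pos hl0 2)).eventually_ge_atTop (48 * (μ : ℝ)),
    hexp.eventually_ge_atTop (4 * R / (θ * c))] with n hn₁ hn₂ hn₃ π hπ
  refine (TABS.toOuterMeasure_q_lt_le hlam hlam1 hβ hβν hβ' hn₁ hn₂ hc hR hθ hπ).trans
    (ENNReal.ofReal_le_ofReal ?_)
  calc 4 * R / (θ * c) * Real.exp (-(θ * β / 3 * N n))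
      ≤ Real.exp (θ * β / 6 * N n) * Real.exp (-(θ * β / 3 * N n)) :=
        mul_le_mul_of_nonneg_right hn₃ (Real.exp_pos _).le
    _ = Real.exp (-(θ * β / 6 * N n)) := by rw [← Real.exp_add]; congr 1; ring
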